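/- Let $\mathbb{K}\in\{\mathbb{R},\mathbb{C}\}$. For a Banach space $Z$ over $\mathbb{K}$ let $\Pi(Z)=\{(z^*,z)\in S_{Z^*}\times S_Z: z^*(z)=1\}$; for a bounded operator $T\in\mathcal{L}(Z)$ let $v(T)=\sup\{|z^*(Tz)|:(z^*,z)\in\Pi(Z)\}$ be its numerical radius, and let $n(Z)=\inf\{v(T):T\in\mathcal{L}(Z),\ \|T\|=1\}$ be the numerical index of $Z$. Let $\mathcal{L}_v(Z)$ denote the space $\mathcal{L}(Z)$ of bounded operators on $Z$ and $\mathcal{K}_v(Z)$ its subspace of compact operators, both equipped with $v$ in place of the operator norm. A subspace $J$ of $E$ is an M-ideal in $E$ if $E^*=J^*\oplus_1 J^\perp$, i.e. if the annihilator $J^\perp$ is the range of a linear projection $P$ on $E^*$ with $\|f\|=\|Pf\|+\|f-Pf\|$ for all $f\in E^*$. An operator $R:E\to F$ attains its norm if $\|Rx\|=\|R\|$ for some $x$ in the closed unit ball of $E$. For $1\le r\le\infty$, $\oplus_r$ denotes the $\ell_r$-sum of two spaces. **Proposition.** Let $X$ and $Y$ be Banach spaces over $\mathbb{K}$ and let $1\le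 q<p<\infty$ be such that $n(X\oplus_p\mathbb{K})>0$ and $n(Y\oplus_q\mathbb{K})>0$. If there is an operator $T\in\mathcal{L}(X,Y)$ whose adjoint $T^*:Y^*\to X^*$ does not attain its norm, then: 1. $\mathcal{K}_v\big((X\oplus_p\mathbb{K})\oplus_\infty(Y\oplus_q\mathbb{K})\big)$ is not an M-ideal in $\mathcal{L}_v\big((X\oplus_p\mathbb{K})\oplus_\infty(Y\oplus_q\mathbb{K})\big)$; 2. $\mathcal{K}_v\big((X\oplus_p\mathbb{K})\oplus_1(Y\oplus_q\mathbb{K})\big)$ is not an M-ideal in $\mathcal{L}_v\big((X\oplus_p\mathbb{K})\oplus_1(Y\oplus_q\mathbb{K})\big)$. -/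

import Mathlib

open scoped ENNReal

noncomputable section

section NumericalRadius

variable (𝕜 : Type*) [RCLike 𝕜] (Z : Type*) [NormedAddCommGroup Z] [NormedSpace 𝕜 Z]

/-- The set `Π(Z)` of pairs `(z*, z)` in `S_{Z*} × S_Z` with `z*(z) = 1`. -/
def statePairs : Set (StrongDual 𝕜 Z × Z) :=
  {s | ‖s.1‖ = 1 ∧ ‖s.2‖ = 1 ∧ s.1 s.2 = 1}

variable {𝕜 Z}

/-- The numerical radius `v(T) = sup {|z*(T z)| : (z*, z) ∈ Π(Z)}`. -/
def numRadius (T : Z →L[𝕜] Z) : ℝ :=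
  sSup ((fun s : StrongDual 𝕜 Z × Z => ‖s.1 (T s.2)‖) '' statePairs 𝕜 Z)

variable (𝕜 Z)

/-- The numerical index `n(Z) = inf {v(T) : ‖T‖ = 1}`. -/
def numIndex : ℝ :=
  sInf (numRadius '' {T : Z →L[𝕜] Z | ‖T‖ = 1})

variable {𝕜 Z}

theorem norm_apply_le_of_mem_statePairs (T : Z →L[𝕜] Z) {s : StrongDual 𝕜 Z × Z}
    (hs : s ∈ statePairs 𝕜 Z) : ‖s.1 (T s.2)‖ ≤ ‖T‖ := by
  obtain ⟨h1, h2, -⟩ := hs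
  calc ‖s.1 (T s.2)‖ ≤ ‖s.1‖ * ‖T s.2‖ := s.1.le_opNorm _
    _ ≤ ‖s.1‖ * (‖T‖ * ‖s.2‖) := by gcongr; exact T.le_opNorm _
    _ = ‖T‖ := by rw [h1, h2]; ring

theorem bddAbove_numRadius (T : Z →L[𝕜] Z) :
    BddAbove ((fun s : StrongDual 𝕜 Z × Z => ‖s.1 (T s.2)‖) '' statePairs 𝕜 Z) := by
  refine ⟨‖T‖, ?_⟩
  rintro _ ⟨s, hs, rfl⟩
  exact norm_apply_le_of_mem_statePairs T hs

theorem norm_apply_le_numRadius (T : Z →L[𝕜] Z) {s : StrongDual 𝕜 Z × Z}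
    (hs : s ∈ statePairs 𝕜 Z) : ‖s.1 (T s.2)‖ ≤ numRadius T :=
  le_csSup (bddAbove_numRadius T) ⟨s, hs, rfl⟩

theorem numRadius_nonneg (T : Z →L[𝕜] Z) : 0 ≤ numRadius T := by
  refine Real.sSup_nonneg ?_
  rintro _ ⟨s, -, rfl⟩
  exact norm_nonneg _

theorem numRadius_add_le (S T : Z →L[𝕜] Z) : numRadius (S + T) ≤ numRadius S + numRadius T := by
  refine Real.sSup_le ?_ (add_nonneg (numRadius_nonneg S) (numRadius_nonneg T))
  rintro _ ⟨s, hs, rfl⟩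
  simp only [add_apply, map_add]
  exact (norm_add_le _ _).trans
    (add_le_add (norm_apply_le_numRadius S hs) (norm_apply_le_numRadius T hs))

theorem numRadius_smul (c : 𝕜) (T : Z →L[𝕜] Z) : numRadius (c • T) = ‖c‖ * numRadius T := by
  unfold numRadius
  rw [← smul_eq_mul, ← Real.sSup_smul_of_nonneg (norm_nonneg c), ← Set.image_smul,
    Set.image_image]
  simp

variable (𝕜 Z)

/-- `𝓛_v(Z)`: the space of bounded operators on `Z`, normed by the numerical radius. For a general
`Z` this is a seminorm; it is a norm equivalent to the operator norm when `n(Z) > 0`. -/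
def NumRadOp : Type _ := Z →L[𝕜] Z

namespace NumRadOp

instance : AddCommGroup (NumRadOp 𝕜 Z) := inferInstanceAs (AddCommGroup (Z →L[𝕜] Z))

instance : Module 𝕜 (NumRadOp 𝕜 Z) := inferInstanceAs (Module 𝕜 (Z →L[𝕜] Z))

/-- The identity map from `𝓛(Z)` to `𝓛_v(Z)`. -/
def of : (Z →L[𝕜] Z) ≃ₗ[𝕜] NumRadOp 𝕜 Z := LinearEquiv.refl 𝕜 (Z →L[𝕜] Z)

instance : Norm (NumRadOp 𝕜 Z) := ⟨fun T => numRadius ((of 𝕜 Z).symm T)⟩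

theorem seminormedCore : SeminormedSpace.Core 𝕜 (NumRadOp 𝕜 Z) where
  norm_nonneg T := numRadius_nonneg ((of 𝕜 Z).symm T)
  norm_smul c T := numRadius_smul c ((of 𝕜 Z).symm T)
  norm_triangle S T := numRadius_add_le ((of 𝕜 Z).symm S) ((of 𝕜 Z).symm T)

instance : SeminormedAddCommGroup (NumRadOp 𝕜 Z) :=
  SeminormedAddCommGroup.ofCore (seminormedCore 𝕜 Z)

instance : NormedSpace 𝕜 (NumRadOp 𝕜 Z) :=
  { norm_smul_le := fun c T => (numRadius_smul c ((of 𝕜 Z).symm T)).le }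

theorem norm_of (T : Z →L[𝕜] Z) : ‖of 𝕜 Z T‖ = numRadius T := rfl

/-- `𝓚_v(Z)`: the compact operators, as a subspace of `𝓛_v(Z)`. -/
def compacts : Submodule 𝕜 (NumRadOp 𝕜 Z) :=
  (compactOperator (RingHom.id 𝕜) Z Z).map (of 𝕜 Z).toLinearMap

end NumRadOp

end NumericalRadius

/-- A subspace `J` of `E` is an M-ideal if `E* = J* ⊕₁ J^⊥`, that is, the annihilator `J^⊥` of `J`
is the range of an L-projection `P` of `E*`: `P² = P` and `‖f‖ = ‖P f‖ + ‖f - P f‖` for all `f`.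
(Restriction to `J` identifies the kernel of `P` with `J*`.) Closedness of `J` is not made part
of the definition, so that the negation does not hold merely because `J` is not closed. -/
def IsMIdeal {𝕜 : Type*} [RCLike 𝕜] {E : Type*} [SeminormedAddCommGroup E] [NormedSpace 𝕜 E]
    (J : Submodule 𝕜 E) : Prop :=
  ∃ P : StrongDual 𝕜 E →L[𝕜] StrongDual 𝕜 E,
    (∀ f, P (P f) = P f) ∧ (∀ f, ‖f‖ = ‖P f‖ + ‖f - P f‖) ∧
      Set.range P = {f : StrongDual 𝕜 E | ∀ x ∈ J, f x = 0}

/-- The adjoint `T* : Y* → X*`, `T* y* = y* ∘ T`. -/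
def adjointOp {𝕜 : Type*} [RCLike 𝕜] {X Y : Type*} [NormedAddCommGroup X] [NormedSpace 𝕜 X]
    [NormedAddCommGroup Y] [NormedSpace 𝕜 Y] (T : X →L[𝕜] Y) :
    StrongDual 𝕜 Y →L[𝕜] StrongDual 𝕜 X :=
  T.precomp 𝕜

theorem adjointOp_apply {𝕜 : Type*} [RCLike 𝕜] {X Y : Type*} [NormedAddCommGroup X]
    [NormedSpace 𝕜 X] [NormedAddCommGroup Y] [NormedSpace 𝕜 Y] (T : X →L[𝕜] Y)
    (g : StrongDual 𝕜 Y) (x : X) : adjointOp T g x = g (T x) := rfl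

/-- `T` attains its norm: `‖T x‖ = ‖T‖` for some `x` in the closed unit ball. (With the ball in
place of the sphere, the zero operator attains its norm also on the zero space.) -/
def AttainsNorm {𝕜 : Type*} [RCLike 𝕜] {E F : Type*} [NormedAddCommGroup E] [NormedSpace 𝕜 E]
    [NormedAddCommGroup F] [NormedSpace 𝕜 F] (T : E →L[𝕜] F) : Prop :=
  ∃ x : E, ‖x‖ ≤ 1 ∧ ‖T x‖ = ‖T‖

end

/-! Put `E = X ⊕_p 𝕜`, `F = Y ⊕_q 𝕜`. On `E ⊕_r F` with `r = 1` or `∞`, averaging two states shows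
that the numerical radius dominates the norm of the block `E → F`. So `𝓛(E, F)` is a contractive
retract of `𝓛_v(E ⊕_r F)`, compatibly with compact operators, and the M-ideal property would descend
to `𝓚(E, F)` (`IsMIdeal.of_retract`). If `𝓚(E, F)` is an M-ideal, any operator closer to a compact
one than its own norm has a norm-attaining adjoint (`IsMIdeal.exists_norm_comp_eq`); this rests on
Milman's theorem applied to the functionals `R ↦ u (g ∘ R)`. The operator `S (x, a) = (T x, ‖T‖ a)`
violates this: it differs from a rank-at-most-one operator by norm at most `‖T‖`, while `q < p`
forces `‖S‖ > ‖T‖`, and its adjoint inherits non-attainment from that of `T`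
(`norm_comp_lpProdMap_lt`). -/

/-! ### Milman's theorem on extreme points of closed convex hulls. -/

section Milman

variable {V : Type*} [AddCommGroup V] [Module ℝ V] [TopologicalSpace V]
  [IsTopologicalAddGroup V] [ContinuousSMul ℝ V]

theorem isCompact_convexJoin {s t : Set V} (hs : IsCompact s) (ht : IsCompact t) :
    IsCompact (convexJoin ℝ s t) := by
  have h : convexJoin ℝ s t =
      (fun x : ℝ × V × V => (1 - x.1) • x.2.1 + x.1 • x.2.2) '' (Set.Icc (0 : ℝ) 1 ×ˢ s ×ˢ t) := by
    ext z
    simp only [mem_convexJoin, segment_eq_image, Set.mem_image, Set.mem_prod, Prod.exists]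
    constructor
    · rintro ⟨a, ha, b, hb, θ, hθ, rfl⟩
      exact ⟨θ, a, b, ⟨hθ, ha, hb⟩, rfl⟩
    · rintro ⟨θ, a, b, ⟨hθ, ha, hb⟩, rfl⟩
      exact ⟨a, ha, b, hb, θ, hθ, rfl⟩
  rw [h]
  exact (isCompact_Icc.prod (hs.prod ht)).image (by fun_prop)

theorem isCompact_convexHull_biUnion {ι : Type*} (I : Finset ι) (K : ι → Set V)
    (hc : ∀ i, IsCompact (K i)) (hK : ∀ i, Convex ℝ (K i)) :
    IsCompact (convexHull ℝ (⋃ i ∈ I, K i)) := by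
  classical
  induction I using Finset.induction_on with
  | empty => simp
  | insert i I hi ih =>
    rw [Finset.set_biUnion_insert]
    rcases (K i).eq_empty_or_nonempty with h | h
    · simpa [h] using ih
    rcases (⋃ j ∈ I, K j).eq_empty_or_nonempty with h' | h'
    · rw [h', Set.union_empty, (hK i).convexHull_eq]
      exact hc i
    · rw [convexHull_union h h', (hK i).convexHull_eq]
      exact isCompact_convexJoin (hc i) ih

/-- Milman's converse of the Krein-Milman theorem. -/
theorem extremePoints_closure_convexHull_subset [T2Space V] [LocallyConvexSpace ℝ V] {A : Set V}
    (hA : IsCompact A) (hC : IsCompact (closure (convexHull ℝ A))) :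
    (closure (convexHull ℝ A)).extremePoints ℝ ⊆ A := by
  classical
  intro x hx
  by_contra hxA
  have hN : ∀ a ∈ A, ∃ N : Set V, N ∈ nhds a ∧ IsClosed N ∧ Convex ℝ N ∧ x ∉ N := by
    intro a ha
    have hne : a ≠ x := fun h => hxA (h ▸ ha)
    obtain ⟨l, hl⟩ := geometric_hahn_banach_point_point hne
    obtain ⟨r, h1, h2⟩ := exists_between hl
    refine ⟨{y | l y ≤ r}, ?_, isClosed_le l.continuous continuous_const,
      convex_halfSpace_le l.toLinearMap.isLinear r, ?_⟩
    · exact Filter.mem_of_superset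
        ((isOpen_lt l.continuous continuous_const).mem_nhds h1) fun y (hy : l y < r) => hy.le
    · simpa using h2
  choose! N hNn hNc hNv hxN using hN
  obtain ⟨I, hIA, hI⟩ := hA.elim_nhds_subcover N hNn
  set C := closure (convexHull ℝ A) with hCdef
  have hCv : Convex ℝ C := (convex_convexHull ℝ A).closure
  -- The value `∅` off `A` makes compactness and convexity hold for every index.
  let K : V → Set V := fun a => if a ∈ A then C ∩ N a else ∅
  have hKc : ∀ a, IsCompact (K a) := by
    intro a
    by_cases ha : a ∈ A
    · simpa [K, ha] using hC.inter_right (hNc a ha)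
    · simp [K, ha]
  have hKv : ∀ a, Convex ℝ (K a) := by
    intro a
    by_cases ha : a ∈ A
    · simpa [K, ha] using hCv.inter (hNv a ha)
    · simp [K, ha, convex_empty]
  have hKC : (⋃ a ∈ I, K a) ⊆ C := by
    refine Set.iUnion₂_subset fun a ha => ?_
    simp [K, hIA a ha]
  have hAK : A ⊆ ⋃ a ∈ I, K a := by
    intro y hy
    obtain ⟨a, ha, hya⟩ := Set.mem_iUnion₂.1 (hI hy)
    refine Set.mem_iUnion₂.2 ⟨a, ha, ?_⟩
    simp only [K, hIA a ha, if_true]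
    exact ⟨subset_closure (subset_convexHull ℝ A hy), hya⟩
  have hsub : C ⊆ convexHull ℝ (⋃ a ∈ I, K a) :=
    closure_minimal (convexHull_mono hAK) (isCompact_convexHull_biUnion I K hKc hKv).isClosed
  -- Extreme points of a convex hull lie in the generating set, so `x` would fall in some `N a`, all
  -- of which avoid it.
  have hx' : x ∈ (convexHull ℝ (⋃ a ∈ I, K a)).extremePoints ℝ :=
    inter_extremePoints_subset_extremePoints_of_subset (convexHull_min hKC hCv)
      ⟨hsub hx.1, hx⟩
  obtain ⟨a, ha, hxa⟩ := Set.mem_iUnion₂.1 (extremePoints_convexHull_subset hx')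
  simp only [K, hIA a ha, if_true] at hxa
  exact hxN a (hIA a ha) hxa.2

end Milman

/-! ### Extreme points of the dual ball and norming sets. -/

section MIdeal

variable {𝕜 : Type*} [RCLike 𝕜]

theorem RCLike.re_le_of_norm_le {z : 𝕜} {c : ℝ} (h : ‖z‖ ≤ c) : RCLike.re z ≤ c :=
  (RCLike.re_le_norm z).trans h

/-- An extreme point of the dual unit ball of a normed space lies in every weak*-compact norming
subset of it. -/
theorem extremePoints_dual_ball_subset {W : Type*} [NormedAddCommGroup W] [NormedSpace 𝕜 W]
    {A : Set (WeakDual 𝕜 W)} (hA : IsCompact A)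
    (hA1 : ∀ a ∈ A, ‖WeakDual.toStrongDual a‖ ≤ 1)
    (hnorm : ∀ (x : W) (c : ℝ), (∀ a ∈ A, RCLike.re (a x) ≤ c) → ‖x‖ ≤ c) :
    (WeakDual.toStrongDual ⁻¹' Metric.closedBall (0 : StrongDual 𝕜 W) 1).extremePoints ℝ ⊆ A := by
  set B : Set (WeakDual 𝕜 W) := WeakDual.toStrongDual ⁻¹' Metric.closedBall 0 1 with hB
  have : LocallyConvexSpace ℝ (WeakDual 𝕜 W) :=
    inferInstanceAs (LocallyConvexSpace ℝ (WeakBilin (topDualPairing 𝕜 W)))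
  have : IsScalarTower ℝ 𝕜 (WeakDual 𝕜 W) :=
    inferInstanceAs (IsScalarTower ℝ 𝕜 (W →L[𝕜] 𝕜))
  have hBc : IsCompact B := WeakDual.isCompact_closedBall 0 1
  have hBv : Convex ℝ B := by
    have := (convex_closedBall (0 : StrongDual 𝕜 W) 1)
    intro f hf g hg a b ha hb hab
    exact this hf hg ha hb hab
  have hAB : A ⊆ B := fun a ha => by simpa [hB] using hA1 a ha
  have hle : closure (convexHull ℝ A) ⊆ B := closure_minimal (convexHull_min hAB hBv) hBc.isClosed
  have heq : closure (convexHull ℝ A) = B := by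
    refine hle.antisymm fun f hf => ?_
    by_contra hfC
    obtain ⟨l, r, hl, hr⟩ := RCLike.geometric_hahn_banach_closed_point (𝕜 := 𝕜)
      (convex_convexHull ℝ A).closure isClosed_closure hfC
    -- A weak*-continuous functional is evaluation at a vector, so the separation contradicts
    -- `hnorm`.
    obtain ⟨x, rfl⟩ := LinearMap.dualEmbedding_surjective (topDualPairing 𝕜 W) l
    have h1 : ‖x‖ ≤ r := hnorm x r fun a ha =>
      (hl a (subset_closure (subset_convexHull ℝ A ha))).le
    have h2 : ‖WeakDual.toStrongDual f‖ ≤ 1 := by simpa [hB] using hf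
    have h3 : RCLike.re (WeakDual.toStrongDual f x) ≤ ‖x‖ := by
      refine RCLike.re_le_of_norm_le ((ContinuousLinearMap.le_opNorm _ _).trans ?_)
      exact mul_le_of_le_one_left (norm_nonneg _) h2
    have h4 : r < RCLike.re (WeakDual.toStrongDual f x) := hr
    linarith
  rw [← heq]
  exact extremePoints_closure_convexHull_subset hA (heq ▸ hBc)

end MIdeal

/-! ### M-ideals and functionals attaining the norm of a given vector. -/

section MIdeal

variable {𝕜 : Type*} [RCLike 𝕜]

/-- Restriction of functionals to a subspace, as a weak*-continuous map. -/
noncomputable def weakDualRestrict {V : Type*} [NormedAddCommGroup V] [NormedSpace 𝕜 V] (J : Submodule 𝕜 V)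
    (f : WeakDual 𝕜 V) : WeakDual 𝕜 J :=
  StrongDual.toWeakDual ((WeakDual.toStrongDual f).comp J.subtypeL)

theorem continuous_weakDualRestrict {V : Type*} [NormedAddCommGroup V] [NormedSpace 𝕜 V]
    (J : Submodule 𝕜 V) : Continuous (weakDualRestrict J) :=
  WeakDual.continuous_of_continuous_eval fun x => WeakDual.eval_continuous (x : V)

/-- If `J` is an M-ideal and `s` is at distance less than `‖s‖` from `J`, then every norming set of
functionals that is weak*-compact on `J` contains one that attains its maximal value `‖s‖` at
`s`. -/
theorem IsMIdeal.exists_mem_re_apply_eq_norm {V : Type*} [NormedAddCommGroup V] [NormedSpace 𝕜 V]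
    {J : Submodule 𝕜 V} (hJ : IsMIdeal J) {s k : V} (hk : k ∈ J) (hsk : ‖s - k‖ < ‖s‖)
    {A : Set (StrongDual 𝕜 V)} (hA1 : ∀ a ∈ A, ‖a‖ ≤ 1)
    (hAc : IsCompact ((fun a => weakDualRestrict J (StrongDual.toWeakDual a)) '' A))
    (hnorm : ∀ x ∈ J, ∀ c : ℝ, (∀ a ∈ A, RCLike.re (a x) ≤ c) → ‖x‖ ≤ c) :
    ∃ a ∈ A, RCLike.re (a s) = ‖s‖ := by
  obtain ⟨P, hPP, hPn, hPr⟩ := hJ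
  have hPJ : ∀ f, ∀ x ∈ J, P f x = 0 := fun f => by
    have : P f ∈ Set.range P := ⟨f, rfl⟩
    rw [hPr] at this
    exact this
  have hre : ∀ f : StrongDual 𝕜 V, ‖f‖ ≤ 1 → RCLike.re (f s) ≤ ‖s‖ := fun f hf =>
    (RCLike.re_le_norm _).trans ((f.le_opNorm s).trans (mul_le_of_le_one_left (norm_nonneg _) hf))
  -- Since `P f` kills `k`, `‖s‖ ≤ ‖P f‖ ‖s - k‖ + (‖f‖ - ‖P f‖) ‖s‖`, and `‖s - k‖ < ‖s‖` leaves no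
  -- room for `P f`.
  have hP0 : ∀ f : StrongDual 𝕜 V, ‖f‖ ≤ 1 → RCLike.re (f s) = ‖s‖ → P f = 0 := by
    intro f hf hfs
    have h1 : ‖P f s‖ ≤ ‖P f‖ * ‖s - k‖ := by
      have : P f s = P f (s - k) := by rw [map_sub, hPJ f k hk, sub_zero]
      rw [this]
      exact (P f).le_opNorm _
    have h2 := (f - P f).le_opNorm s
    have h3 : ‖s‖ ≤ ‖P f s‖ + ‖(f - P f) s‖ := by
      rw [← hfs]
      refine (RCLike.re_le_norm _).trans ?_
      have : f s = P f s + (f - P f) s := by simp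
      conv_lhs => rw [this]
      exact norm_add_le _ _
    have h4 := hPn f
    have h5 := norm_nonneg (P f)
    rw [← norm_le_zero_iff]
    nlinarith [norm_nonneg s]
  -- A functional norming `s` is the only extension in the ball of its restriction to `J`: here `P g
  -- = g - f`, so `‖g‖ = ‖g - f‖ + ‖f‖` with `‖f‖ ≥ 1`.
  have huniq : ∀ f g : StrongDual 𝕜 V, ‖f‖ ≤ 1 → RCLike.re (f s) = ‖s‖ → ‖g‖ ≤ 1 →
      (∀ x ∈ J, g x = f x) → g = f := by
    intro f g hf hfs hg hgf
    have h0 : 0 < ‖s‖ := (norm_nonneg _).trans_lt hsk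
    have hf1 : 1 ≤ ‖f‖ := by
      have := (RCLike.re_le_norm (f s)).trans (f.le_opNorm s)
      rw [hfs] at this
      nlinarith
    have hfix : P (g - f) = g - f := by
      have hmem : g - f ∈ Set.range P := by
        rw [hPr]
        intro x hx
        simp [hgf x hx]
      obtain ⟨h, hh⟩ := hmem
      rw [← hh]
      exact hPP h
    have hPg : P g = g - f := by
      rw [← hfix, map_sub, hP0 f hf hfs, sub_zero]
    have := hPn g
    rw [hPg, sub_sub_cancel] at this
    rw [← sub_eq_zero, ← norm_le_zero_iff]
    linarith
  let B : Set (WeakDual 𝕜 V) := WeakDual.toStrongDual ⁻¹' Metric.closedBall 0 1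
  let F : Set (WeakDual 𝕜 V) := B ∩ {f | RCLike.re (f s) = ‖s‖}
  have hFB : ∀ f : WeakDual 𝕜 V, f ∈ F ↔
      ‖WeakDual.toStrongDual f‖ ≤ 1 ∧ RCLike.re (f s) = ‖s‖ := fun f => by simp [F, B]
  have hFc : IsCompact F := (WeakDual.isCompact_closedBall 0 1).inter_right
    (isClosed_eq (RCLike.continuous_re.comp (WeakDual.eval_continuous s)) continuous_const)
  have hFne : F.Nonempty := by
    obtain ⟨f, hf, hfs⟩ := exists_dual_vector'' 𝕜 s
    exact ⟨StrongDual.toWeakDual f, (hFB _).2 ⟨hf, by simp [hfs]⟩⟩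
  have : LocallyConvexSpace ℝ (WeakDual 𝕜 J) :=
    inferInstanceAs (LocallyConvexSpace ℝ (WeakBilin (topDualPairing 𝕜 J)))
  -- An extreme point of the restricted face is extreme in the whole dual ball of `J`: extending the
  -- ends of a segment through `ψ`, uniqueness makes the combination equal `φ`, so both extensions
  -- norm `s` and lie in the face.
  obtain ⟨ψ, hψ⟩ := (hFc.image (continuous_weakDualRestrict J)).extremePoints_nonempty
    (hFne.image _)
  have hψA : ψ ∈ (fun a => weakDualRestrict J (StrongDual.toWeakDual a)) '' A := by
    refine extremePoints_dual_ball_subset hAc ?_ ?_ ?_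
    · rintro _ ⟨a, ha, rfl⟩
      refine (ContinuousLinearMap.opNorm_comp_le _ _).trans ?_
      exact mul_le_one₀ (hA1 a ha) (norm_nonneg _) J.norm_subtypeL_le
    · intro x c hx
      exact hnorm x x.2 c fun a ha => hx _ ⟨a, ha, rfl⟩
    · obtain ⟨φ, hφ, rfl⟩ := hψ.1
      obtain ⟨hφ1, hφs⟩ := (hFB φ).1 hφ
      refine mem_extremePoints_iff_left.2 ⟨?_, ?_⟩
      · have := (ContinuousLinearMap.opNorm_comp_le (WeakDual.toStrongDual φ) J.subtypeL).trans
          (mul_le_one₀ hφ1 (norm_nonneg _) J.norm_subtypeL_le)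
        exact mem_closedBall_zero_iff.2 this
      · intro ψ₁ h₁ ψ₂ h₂ hseg
        obtain ⟨f₁, hf₁, hn₁⟩ := exists_extension_norm_eq J (WeakDual.toStrongDual ψ₁)
        obtain ⟨f₂, hf₂, hn₂⟩ := exists_extension_norm_eq J (WeakDual.toStrongDual ψ₂)
        have hb₁ : ‖f₁‖ ≤ 1 := by rw [hn₁]; simpa using h₁
        have hb₂ : ‖f₂‖ ≤ 1 := by rw [hn₂]; simpa using h₂
        have hseg' := hseg
        obtain ⟨a, b, ha, hb, hab, hψab⟩ := hseg
        have hcomb : a • f₁ + b • f₂ = WeakDual.toStrongDual φ := by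
          refine huniq _ _ hφ1 hφs ?_ ?_
          · have := convex_closedBall (0 : StrongDual 𝕜 V) 1 (mem_closedBall_zero_iff.2 hb₁)
              (mem_closedBall_zero_iff.2 hb₂) ha.le hb.le hab
            simpa using this
          · intro x hx
            have h := DFunLike.congr_fun hψab (⟨x, hx⟩ : J)
            have e₁ := hf₁ ⟨x, hx⟩
            have e₂ := hf₂ ⟨x, hx⟩
            have h' : a • ψ₁ ⟨x, hx⟩ + b • ψ₂ ⟨x, hx⟩ = φ x := h
            rw [← show (WeakDual.toStrongDual φ) x = φ x from rfl] at h'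
            rw [← h']
            change a • f₁ x + b • f₂ x = _
            rw [show f₁ x = ψ₁ ⟨x, hx⟩ from e₁, show f₂ x = ψ₂ ⟨x, hx⟩ from e₂]
        have hval : a * RCLike.re (f₁ s) + b * RCLike.re (f₂ s) = ‖s‖ := by
          rw [← hφs, ← show (WeakDual.toStrongDual φ) s = φ s from rfl, ← hcomb]
          simp [RCLike.smul_re]
        have hr₁ := hre f₁ hb₁
        have hr₂ := hre f₂ hb₂
        have hs₁ : RCLike.re (f₁ s) = ‖s‖ := by
          refine le_antisymm hr₁ ?_
          have : b = 1 - a := by linarith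
          subst this
          nlinarith
        have hs₂ : RCLike.re (f₂ s) = ‖s‖ := by
          refine le_antisymm hr₂ ?_
          have : a = 1 - b := by linarith
          subst this
          nlinarith
        refine (mem_extremePoints_iff_left.1 hψ).2 ψ₁ ?_ ψ₂ ?_ hseg'
        · exact ⟨StrongDual.toWeakDual f₁, (hFB _).2 ⟨hb₁, hs₁⟩, DFunLike.ext _ _ hf₁⟩
        · exact ⟨StrongDual.toWeakDual f₂, (hFB _).2 ⟨hb₂, hs₂⟩, DFunLike.ext _ _ hf₂⟩
  obtain ⟨a, ha, haψ⟩ := hψA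
  obtain ⟨φ, hφ, rfl⟩ := hψ.1
  obtain ⟨hφ1, hφs⟩ := (hFB φ).1 hφ
  have : a = WeakDual.toStrongDual φ := by
    refine huniq _ _ hφ1 hφs (hA1 a ha) fun x hx => ?_
    exact DFunLike.congr_fun haψ (⟨x, hx⟩ : J)
  exact ⟨a, ha, by rw [this]; exact hφs⟩

end MIdeal

/-! ### Norm attainment of adjoints when the compact operators form an M-ideal. -/

section CompactOperators

variable {𝕜 : Type*} [RCLike 𝕜] {E F : Type*} [NormedAddCommGroup E] [NormedSpace 𝕜 E]
  [NormedAddCommGroup F] [NormedSpace 𝕜 F]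

open Filter Topology

theorem mem_weakDual_unitBall {V : Type*} [SeminormedAddCommGroup V] [NormedSpace 𝕜 V]
    {f : WeakDual 𝕜 V} : f ∈ WeakDual.toStrongDual ⁻¹' Metric.closedBall (0 : StrongDual 𝕜 V) 1 ↔
      ‖WeakDual.toStrongDual f‖ ≤ 1 := by
  simp

/-- Composition with a compact operator is weak*-to-norm continuous on the dual unit ball. -/
theorem IsCompactOperator.continuousOn_precomp {K : E →L[𝕜] F} (hK : IsCompactOperator K) :
    ContinuousOn (fun g : WeakDual 𝕜 F => (WeakDual.toStrongDual g).comp K)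
      (WeakDual.toStrongDual ⁻¹' Metric.closedBall (0 : StrongDual 𝕜 F) 1) := by
  intro g₀ hg₀
  rw [ContinuousWithinAt, Metric.tendsto_nhds]
  intro ε hε
  obtain ⟨C, hC, hKC⟩ := IsCompactOperator.image_closedBall_subset_compact (𝕜₁ := 𝕜)
    (f := (K : E →ₗ[𝕜] F)) hK 1
  -- Differences of functionals in the ball have norm at most 2, so the net costs `2 * (ε / 8)`, and
  -- the values on the net another `ε / 4`.
  obtain ⟨t, ht, htC⟩ := Metric.totallyBounded_iff.1 hC.totallyBounded (ε / 8) (by positivity)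
  have hev : ∀ᶠ g in 𝓝[WeakDual.toStrongDual ⁻¹' Metric.closedBall 0 1] g₀,
      ∀ y ∈ t, ‖g y - g₀ y‖ < ε / 4 := by
    rw [eventually_all_finite ht]
    intro y _
    have h := ((WeakDual.eval_continuous y).tendsto g₀).mono_left
      (nhdsWithin_le_nhds (s := WeakDual.toStrongDual ⁻¹' Metric.closedBall 0 1))
    simpa [dist_eq_norm] using Metric.tendsto_nhds.1 h (ε / 4) (by positivity)
  filter_upwards [hev, self_mem_nhdsWithin] with g hg hgB
  have hg1 : ‖WeakDual.toStrongDual g‖ ≤ 1 := by simpa using hgB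
  have hg01 : ‖WeakDual.toStrongDual g₀‖ ≤ 1 := by simpa using hg₀
  rw [dist_eq_norm]
  refine lt_of_le_of_lt (b := ε / 2) ?_ (by linarith)
  refine ContinuousLinearMap.opNorm_le_of_unit_norm (by positivity) fun x hx => ?_
  obtain ⟨y, hy, hxy⟩ := Set.mem_iUnion₂.1
    (htC (hKC ⟨x, by simpa using hx.le, rfl⟩))
  set h := WeakDual.toStrongDual g - WeakDual.toStrongDual g₀ with hdef
  have h2 : ‖h‖ ≤ 2 := (norm_sub_le _ _).trans (by linarith)
  have h1 : ‖K x - y‖ < ε / 8 := by simpa [dist_eq_norm] using hxy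
  have h3 : ‖h y‖ < ε / 4 := hg y hy
  calc ‖((WeakDual.toStrongDual g).comp K - (WeakDual.toStrongDual g₀).comp K) x‖
      = ‖h y + h (K x - y)‖ := by rw [← map_add]; simp [hdef]
    _ ≤ ‖h y‖ + ‖h (K x - y)‖ := norm_add_le _ _
    _ ≤ ε / 4 + 2 * (ε / 8) := by
        gcongr
        exact (h.le_opNorm _).trans (by gcongr)
    _ = ε / 2 := by ring

/-- The functional `R ↦ u (g ∘ R)` on `𝓛(E, F)`. -/
noncomputable def biDualFunctional (u : StrongDual 𝕜 (StrongDual 𝕜 E)) (g : StrongDual 𝕜 F) :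
    StrongDual 𝕜 (E →L[𝕜] F) :=
  u.comp (ContinuousLinearMap.compL 𝕜 E F 𝕜 g)

theorem biDualFunctional_apply (u : StrongDual 𝕜 (StrongDual 𝕜 E)) (g : StrongDual 𝕜 F)
    (R : E →L[𝕜] F) : biDualFunctional u g R = u (g.comp R) := rfl

/-- If `𝓚(E, F)` is an M-ideal in `𝓛(E, F)`, then the adjoint of every operator whose essential
norm is smaller than its norm attains its norm. -/
theorem IsMIdeal.exists_norm_comp_eq (h : IsMIdeal (compactOperator (RingHom.id 𝕜) E F))
    {S K : E →L[𝕜] F} (hK : IsCompactOperator K) (hSK : ‖S - K‖ < ‖S‖) :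
    ∃ g : StrongDual 𝕜 F, ‖g‖ ≤ 1 ∧ ‖S‖ ≤ ‖g.comp S‖ := by
  set B₁ : Set (WeakDual 𝕜 (StrongDual 𝕜 E)) :=
    WeakDual.toStrongDual ⁻¹' Metric.closedBall (0 : StrongDual 𝕜 (StrongDual 𝕜 E)) 1
  set B₂ : Set (WeakDual 𝕜 F) := WeakDual.toStrongDual ⁻¹' Metric.closedBall 0 1
  let m : WeakDual 𝕜 (StrongDual 𝕜 E) × WeakDual 𝕜 F → StrongDual 𝕜 (E →L[𝕜] F) := fun z =>
    biDualFunctional (WeakDual.toStrongDual z.1) (WeakDual.toStrongDual z.2)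
  have hle : ∀ z ∈ B₁ ×ˢ B₂, ‖m z‖ ≤ 1 := by
    rintro ⟨u, g⟩ ⟨hu, hg⟩
    have hu' : ‖WeakDual.toStrongDual u‖ ≤ 1 := mem_weakDual_unitBall.1 hu
    have hg' : ‖WeakDual.toStrongDual g‖ ≤ 1 := mem_weakDual_unitBall.1 hg
    refine ContinuousLinearMap.opNorm_le_bound _ zero_le_one fun R => ?_
    calc ‖m (u, g) R‖ ≤ ‖WeakDual.toStrongDual u‖ * ‖(WeakDual.toStrongDual g).comp R‖ :=
          (WeakDual.toStrongDual u).le_opNorm _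
      _ ≤ 1 * (1 * ‖R‖) := by
          gcongr
          exact (ContinuousLinearMap.opNorm_comp_le _ _).trans (by gcongr)
      _ = 1 * ‖R‖ := by ring
  -- Compactness is needed only after restriction to compact `R`, where `(u, g) ↦ u (g ∘ R)` is
  -- jointly weak*-continuous on the balls because `g ↦ g ∘ R` is weak*-to-norm continuous.
  have H : ∃ a ∈ m '' (B₁ ×ˢ B₂), RCLike.re (a S) = ‖S‖ := by
    refine h.exists_mem_re_apply_eq_norm (k := K) hK hSK ?_ ?_ ?_
    · rintro _ ⟨z, hz, rfl⟩
      exact hle z hz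
    · rw [Set.image_image]
      refine ((WeakDual.isCompact_closedBall 0 1).prod
        (WeakDual.isCompact_closedBall 0 1)).image_of_continuousOn ?_
      rw [continuousOn_iff_continuous_domRestrict]
      refine WeakDual.continuous_of_continuous_eval fun R => ?_
      have hR := (IsCompactOperator.continuousOn_precomp R.2).comp continuous_snd.continuousOn
        (fun z (hz : z ∈ B₁ ×ˢ B₂) => hz.2)
      have key : ContinuousOn (fun z : WeakDual 𝕜 (StrongDual 𝕜 E) × WeakDual 𝕜 F =>
          z.1 ((WeakDual.toStrongDual z.2).comp (R : E →L[𝕜] F))) (B₁ ×ˢ B₂) := by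
        intro z₀ hz₀
        have h1 : Tendsto (fun z : WeakDual 𝕜 (StrongDual 𝕜 E) × WeakDual 𝕜 F =>
            z.1 ((WeakDual.toStrongDual z₀.2).comp (R : E →L[𝕜] F))) (𝓝[B₁ ×ˢ B₂] z₀)
            (𝓝 (z₀.1 ((WeakDual.toStrongDual z₀.2).comp (R : E →L[𝕜] F)))) :=
          ((WeakDual.eval_continuous _).comp continuous_fst).continuousWithinAt
        have h2 : Tendsto (fun z : WeakDual 𝕜 (StrongDual 𝕜 E) × WeakDual 𝕜 F =>
            z.1 ((WeakDual.toStrongDual z.2).comp (R : E →L[𝕜] F)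
              - (WeakDual.toStrongDual z₀.2).comp (R : E →L[𝕜] F))) (𝓝[B₁ ×ˢ B₂] z₀) (𝓝 0) := by
          have h3 := tendsto_iff_norm_sub_tendsto_zero.1 (hR z₀ hz₀)
          refine squeeze_zero_norm' ?_ h3
          filter_upwards [self_mem_nhdsWithin] with z hz
          have hz1 : ‖WeakDual.toStrongDual z.1‖ ≤ 1 := mem_weakDual_unitBall.1 hz.1
          exact ((WeakDual.toStrongDual z.1).le_opNorm _).trans
            (mul_le_of_le_one_left (norm_nonneg _) hz1)
        have h4 := h1.add h2
        rw [add_zero] at h4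
        refine h4.congr fun z => ?_
        rw [← map_add, add_sub_cancel]
      exact continuousOn_iff_continuous_domRestrict.1 key
    · intro R _ c hc
      have hc0 : 0 ≤ c := by
        have h0 : RCLike.re (m (0, 0) R) ≤ c := hc _ ⟨(0, 0), ⟨by simp [B₁], by simp [B₂]⟩, rfl⟩
        have h1 : m (0, 0) R = 0 := by simp [m, biDualFunctional_apply]
        rwa [h1, map_zero] at h0
      refine ContinuousLinearMap.opNorm_le_bound _ hc0 fun x => ?_
      obtain ⟨g, hg, hgx⟩ := exists_dual_vector'' 𝕜 (R x)
      obtain ⟨u, hu, hux⟩ := exists_dual_vector'' 𝕜 (g.comp R)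
      have h1 := hc _ ⟨(StrongDual.toWeakDual u, StrongDual.toWeakDual g),
        ⟨mem_weakDual_unitBall.2 hu, mem_weakDual_unitBall.2 hg⟩, rfl⟩
      have h2 : RCLike.re (u (g.comp R)) ≤ c := h1
      rw [hux, RCLike.ofReal_re] at h2
      calc ‖R x‖ = ‖(g.comp R) x‖ := by simp [hgx]
        _ ≤ ‖g.comp R‖ * ‖x‖ := ContinuousLinearMap.le_opNorm _ _
        _ ≤ c * ‖x‖ := by gcongr
  obtain ⟨_, ⟨⟨u, g⟩, ⟨hu, hg⟩, rfl⟩, hre⟩ := H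
  have hu' : ‖WeakDual.toStrongDual u‖ ≤ 1 := mem_weakDual_unitBall.1 hu
  refine ⟨WeakDual.toStrongDual g, by simpa [B₂] using hg, ?_⟩
  rw [← hre]
  refine (RCLike.re_le_norm _).trans
    (((WeakDual.toStrongDual u).le_opNorm ((WeakDual.toStrongDual g).comp S)).trans ?_)
  exact mul_le_of_le_one_left (norm_nonneg _) hu'

end CompactOperators

/-! ### From the numerical radius on a direct sum to operators between the summands. -/

section Blocks

variable {𝕜 : Type*} [RCLike 𝕜]

/-- M-ideals pass to contractively complemented subspaces. -/
theorem IsMIdeal.of_retract {V W : Type*} [SeminormedAddCommGroup V] [NormedSpace 𝕜 V]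
    [SeminormedAddCommGroup W] [NormedSpace 𝕜 W] {J : Submodule 𝕜 V} {I : Submodule 𝕜 W}
    (hJ : IsMIdeal J) (i : W →L[𝕜] V) (π : V →L[𝕜] W) (hi : ‖i‖ ≤ 1) (hπ : ‖π‖ ≤ 1)
    (hπi : ∀ w, π (i w) = w) (hI : ∀ w ∈ I, i w ∈ J) (hIJ : ∀ v ∈ J, π v ∈ I) : IsMIdeal I := by
  obtain ⟨P, hPP, hPn, hPr⟩ := hJ
  have hPJ : ∀ f, ∀ x ∈ J, P f x = 0 := fun f => by
    have : P f ∈ Set.range P := ⟨f, rfl⟩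
    rw [hPr] at this
    exact this
  have hfix : ∀ f : StrongDual 𝕜 V, (∀ x ∈ J, f x = 0) → P f = f := by
    intro f hf
    have : f ∈ Set.range P := by rw [hPr]; exact hf
    obtain ⟨g, rfl⟩ := this
    exact hPP g
  -- `Q = i* P π*`; contractivity of `i` and `π` transfers the L-projection identity.
  let Q : StrongDual 𝕜 W →L[𝕜] StrongDual 𝕜 W := (i.precomp 𝕜).comp (P.comp (π.precomp 𝕜))
  have hQ : ∀ f, Q f = (P (f.comp π)).comp i := fun f => rfl
  have hQI : ∀ f, ∀ w ∈ I, Q f w = 0 := fun f w hw => hPJ _ _ (hI w hw)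
  have hQfix : ∀ f : StrongDual 𝕜 W, (∀ w ∈ I, f w = 0) → Q f = f := by
    intro f hf
    rw [hQ, hfix _ fun x hx => hf _ (hIJ x hx)]
    ext w
    simp [hπi]
  refine ⟨Q, fun f => hQfix _ (hQI f), fun f => ?_, ?_⟩
  · refine le_antisymm ?_ ?_
    · simpa using norm_add_le (Q f) (f - Q f)
    · have h1 : ‖Q f‖ ≤ ‖P (f.comp π)‖ :=
        (ContinuousLinearMap.opNorm_comp_le _ _).trans (mul_le_of_le_one_right (norm_nonneg _) hi)
      have h2 : ‖f - Q f‖ ≤ ‖f.comp π - P (f.comp π)‖ := by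
        have : f - Q f = (f.comp π - P (f.comp π)).comp i := by
          ext w
          simp [hQ, hπi]
        rw [this]
        exact (ContinuousLinearMap.opNorm_comp_le _ _).trans
          (mul_le_of_le_one_right (norm_nonneg _) hi)
      have h3 : ‖f.comp π‖ ≤ ‖f‖ :=
        (ContinuousLinearMap.opNorm_comp_le _ _).trans (mul_le_of_le_one_right (norm_nonneg _) hπ)
      linarith [hPn (f.comp π)]
  · ext f
    exact ⟨by rintro ⟨g, rfl⟩; exact hQI g, fun hf => ⟨f, hQfix f hf⟩⟩

theorem numRadius_le_norm {Z : Type*} [NormedAddCommGroup Z] [NormedSpace 𝕜 Z] (T : Z →L[𝕜] Z) :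
    numRadius T ≤ ‖T‖ := by
  refine Real.sSup_le ?_ (norm_nonneg T)
  rintro _ ⟨s, hs, rfl⟩
  exact norm_apply_le_of_mem_statePairs T hs

theorem mem_statePairs_of_norm_le_one {Z : Type*} [NormedAddCommGroup Z] [NormedSpace 𝕜 Z]
    {f : StrongDual 𝕜 Z} {z : Z} (hf : ‖f‖ ≤ 1) (hz : ‖z‖ ≤ 1) (h : f z = 1) :
    (f, z) ∈ statePairs 𝕜 Z := by
  have h1 : 1 ≤ ‖f‖ * ‖z‖ := by simpa [h] using f.le_opNorm z
  refine ⟨?_, ?_, h⟩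
  · nlinarith [norm_nonneg f, norm_nonneg z]
  · nlinarith [norm_nonneg f, norm_nonneg z]

theorem norm_le_of_norm_add_le_of_norm_sub_le {V : Type*} [NormedAddCommGroup V] [NormedSpace ℝ V] {a d : V}
    {r : ℝ} (h₁ : ‖d + a‖ ≤ r) (h₂ : ‖d - a‖ ≤ r) : ‖a‖ ≤ r := by
  have h : ‖a + a‖ ≤ ‖d + a‖ + ‖d - a‖ := by
    have : a + a = (d + a) - (d - a) := by abel
    rw [this]
    exact norm_sub_le _ _
  rw [← two_smul ℝ a, norm_smul, Real.norm_two] at h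
  linarith

variable {E F : Type*} [NormedAddCommGroup E] [NormedSpace 𝕜 E]
  [NormedAddCommGroup F] [NormedSpace 𝕜 F]

/-- The inclusion of the first summand in an `ℓ_r`-sum. -/
noncomputable def lpInl (r : ℝ≥0∞) [Fact (1 ≤ r)] : E →L[𝕜] WithLp r (E × F) :=
  ((WithLp.prodContinuousLinearEquiv r 𝕜 E F).symm : E × F →L[𝕜] WithLp r (E × F)).comp
    (ContinuousLinearMap.inl 𝕜 E F)

/-- The inclusion of the second summand in an `ℓ_r`-sum. -/
noncomputable def lpInr (r : ℝ≥0∞) [Fact (1 ≤ r)] : F →L[𝕜] WithLp r (E × F) :=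
  ((WithLp.prodContinuousLinearEquiv r 𝕜 E F).symm : E × F →L[𝕜] WithLp r (E × F)).comp
    (ContinuousLinearMap.inr 𝕜 E F)

variable (r : ℝ≥0∞) [Fact (1 ≤ r)]

theorem norm_sndL_le : ‖WithLp.sndL r 𝕜 E F‖ ≤ 1 :=
  ContinuousLinearMap.opNorm_le_bound _ zero_le_one fun z => by
    simpa using WithLp.norm_snd_le E z

/-- If the lower left block of every operator on `E ⊕_r F` is bounded by the numerical radius, then
the M-ideal property passes from `𝓚_v(E ⊕_r F)` to `𝓚(E, F)`. -/
theorem isMIdeal_compactOperator_of_block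
    (hblock : ∀ R : WithLp r (E × F) →L[𝕜] WithLp r (E × F), ∀ e : E, ‖e‖ = 1 →
      ‖(R (WithLp.toLp r (e, 0))).snd‖ ≤ numRadius R)
    (h : IsMIdeal (NumRadOp.compacts 𝕜 (WithLp r (E × F)))) :
    IsMIdeal (compactOperator (RingHom.id 𝕜) E F) := by
  let i₀ : (E →L[𝕜] F) →ₗ[𝕜] NumRadOp 𝕜 (WithLp r (E × F)) :=
    { toFun := fun S => NumRadOp.of 𝕜 _ ((lpInr r).comp (S.comp (WithLp.fstL r 𝕜 E F)))
      map_add' := fun S T => by rw [← map_add]; congr 1; ext z <;> simp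
      map_smul' := fun c S => by rw [RingHom.id_apply, ← map_smul]; congr 1; ext z <;> simp }
  let π₀ : NumRadOp 𝕜 (WithLp r (E × F)) →ₗ[𝕜] (E →L[𝕜] F) :=
    { toFun := fun R => (WithLp.sndL r 𝕜 E F).comp
        (((NumRadOp.of 𝕜 (WithLp r (E × F))).symm R).comp (lpInl r))
      map_add' := fun S T => by ext z; simp
      map_smul' := fun c S => by ext z; simp }
  have hi : ∀ S, ‖i₀ S‖ ≤ 1 * ‖S‖ := by
    intro S
    rw [one_mul]
    refine (numRadius_le_norm _).trans (ContinuousLinearMap.opNorm_le_bound _ (norm_nonneg _) ?_)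
    intro z
    change ‖WithLp.toLp r ((0 : E), S z.fst)‖ ≤ _
    rw [WithLp.norm_toLp_snd]
    exact (S.le_opNorm _).trans (by gcongr; exact WithLp.norm_fst_le E z)
  have hπ : ∀ R, ‖π₀ R‖ ≤ 1 * ‖R‖ := by
    intro R
    rw [one_mul]
    exact ContinuousLinearMap.opNorm_le_of_unit_norm (norm_nonneg _) fun e he => hblock _ e he
  refine h.of_retract (i₀.mkContinuous 1 hi) (π₀.mkContinuous 1 hπ)
    (i₀.mkContinuous_norm_le zero_le_one hi) (π₀.mkContinuous_norm_le zero_le_one hπ) ?_ ?_ ?_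
  · intro S
    ext e
    rfl
  · intro S hS
    refine ⟨_, ?_, rfl⟩
    exact (IsCompactOperator.comp_clm hS (WithLp.fstL r 𝕜 E F)).clm_comp (lpInr r)
  · rintro _ ⟨R, hR, rfl⟩
    exact (IsCompactOperator.comp_clm hR (lpInl r)).clm_comp (WithLp.sndL r 𝕜 E F)

/-- With `y = c / ‖c‖` and `g` norming `c`, both `(±e, y)` are unit vectors of the `ℓ_∞`-sum on
which `g ∘ snd` takes the value 1. Half the difference of the two state values is `g c = ‖c‖`. -/
theorem norm_snd_apply_le_numRadius_top
    (R : WithLp ∞ (E × F) →L[𝕜] WithLp ∞ (E × F)) (e : E) (he : ‖e‖ = 1) :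
    ‖(R (WithLp.toLp ∞ (e, 0))).snd‖ ≤ numRadius R := by
  set c := (R (WithLp.toLp ∞ (e, 0))).snd with hc
  by_cases hc0 : ‖c‖ = 0
  · rw [hc0]
    exact numRadius_nonneg R
  obtain ⟨g, hg, hgc⟩ := exists_dual_vector 𝕜 c hc0
  let y : F := ((‖c‖⁻¹ : ℝ) : 𝕜) • c
  have hy : ‖y‖ = 1 := by simp [y, norm_smul, inv_mul_cancel₀ hc0]
  have hgy : g y = 1 := by
    simp only [y, map_smul, hgc, smul_eq_mul]
    rw [← RCLike.ofReal_mul, inv_mul_cancel₀ hc0, RCLike.ofReal_one]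
  have hf : ‖g.comp (WithLp.sndL ∞ 𝕜 E F)‖ ≤ 1 :=
    (ContinuousLinearMap.opNorm_comp_le _ _).trans
      (mul_le_one₀ hg.le (norm_nonneg _) (norm_sndL_le ∞))
  have hpair : ∀ e' : E, ‖e'‖ ≤ 1 → ‖g (R (WithLp.toLp ∞ (e', y))).snd‖ ≤ numRadius R := by
    intro e' he'
    refine norm_apply_le_numRadius R (mem_statePairs_of_norm_le_one hf ?_ hgy)
    rw [WithLp.prod_norm_eq_sup]
    exact max_le he' hy.le
  have h₁ := hpair e he.le
  have h₂ := hpair (-e) (by simp [he])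
  have e₁ : (WithLp.toLp ∞ (e, y) : WithLp ∞ (E × F)) =
      WithLp.toLp ∞ (0, y) + WithLp.toLp ∞ (e, 0) := by
    rw [← WithLp.toLp_add]; simp
  have e₂ : (WithLp.toLp ∞ (-e, y) : WithLp ∞ (E × F)) =
      WithLp.toLp ∞ (0, y) - WithLp.toLp ∞ (e, 0) := by
    rw [← WithLp.toLp_sub]; simp
  rw [e₁, map_add, WithLp.add_snd, map_add] at h₁
  rw [e₂, map_sub, WithLp.sub_snd, map_sub] at h₂
  have := norm_le_of_norm_add_le_of_norm_sub_le h₁ h₂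
  rwa [← hc, hgc, RCLike.norm_ofReal, abs_norm] at this

/-- Dual to the `ℓ_∞` case: the vector `(e, 0)` is fixed and the sign moves to the functional `(f,
±g)`, where `f` norms `e` and `g` norms `c`. -/
theorem norm_snd_apply_le_numRadius_one
    (R : WithLp 1 (E × F) →L[𝕜] WithLp 1 (E × F)) (e : E) (he : ‖e‖ = 1) :
    ‖(R (WithLp.toLp 1 (e, 0))).snd‖ ≤ numRadius R := by
  set c := (R (WithLp.toLp 1 (e, 0))).snd with hc
  obtain ⟨g, hg, hgc⟩ := exists_dual_vector'' 𝕜 c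
  obtain ⟨f, hf, hfe⟩ := exists_dual_vector'' 𝕜 e
  rw [he, RCLike.ofReal_one] at hfe
  have hpair : ∀ g' : StrongDual 𝕜 F, ‖g'‖ ≤ 1 →
      ‖f (R (WithLp.toLp 1 (e, 0))).fst + g' c‖ ≤ numRadius R := by
    intro g' hg'
    refine norm_apply_le_numRadius R (s := (f.comp (WithLp.fstL 1 𝕜 E F) +
      g'.comp (WithLp.sndL 1 𝕜 E F), WithLp.toLp 1 (e, 0)))
      (mem_statePairs_of_norm_le_one ?_ ?_ ?_)
    · refine ContinuousLinearMap.opNorm_le_bound _ zero_le_one fun z => ?_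
      rw [one_mul, WithLp.prod_norm_eq_of_L1]
      refine (norm_add_le _ _).trans (add_le_add ?_ ?_)
      · exact (f.le_opNorm _).trans (mul_le_of_le_one_left (norm_nonneg _) hf)
      · exact (g'.le_opNorm _).trans (mul_le_of_le_one_left (norm_nonneg _) hg')
    · rw [WithLp.norm_toLp_fst, he]
    · simp [hfe]
  have h₁ := hpair g hg
  have h₂ := hpair (-g) (by rwa [norm_neg])
  have := norm_le_of_norm_add_le_of_norm_sub_le h₁ (by simpa [sub_eq_add_neg] using h₂)
  rwa [hgc, RCLike.norm_ofReal, abs_norm] at this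

end Blocks

/-! ### The operator `(x, a) ↦ (T x, ‖T‖ a)` between `ℓ_p`- and `ℓ_q`-sums. -/

section LpSums

theorem WithLp.norm_toLp_prod_norm {α β : Type*} [SeminormedAddCommGroup α]
    [SeminormedAddCommGroup β] (p : ℝ≥0∞) [hp : Fact (1 ≤ p)] (x : α) (y : β) :
    ‖(WithLp.toLp p (x, y) : WithLp p (α × β))‖ =
      ‖(WithLp.toLp p (‖x‖, ‖y‖) : WithLp p (ℝ × ℝ))‖ := by
  rcases eq_or_ne p ∞ with rfl | h
  · simp [WithLp.prod_norm_eq_sup]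
  · have : 0 < p.toReal := ENNReal.toReal_pos (zero_lt_one.trans_le hp.out).ne' h
    simp [WithLp.prod_norm_eq_add this]

/-- For `q < p < ∞` the formal inclusion `ℓ_p² → ℓ_q²` has norm larger than one. -/
theorem exists_norm_toLp_lt {p q : ℝ≥0∞} [Fact (1 ≤ p)] [hq : Fact (1 ≤ q)] (hqp : q < p)
    (hp : p < ∞) : ∃ c : ℝ, 0 ≤ c ∧ ‖(WithLp.toLp p (c, c) : WithLp p (ℝ × ℝ))‖ ≤ 1 ∧
      1 < ‖(WithLp.toLp q (c, c) : WithLp q (ℝ × ℝ))‖ := by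
  have hQ : 0 < q.toReal :=
    ENNReal.toReal_pos (zero_lt_one.trans_le hq.out).ne' (hqp.trans hp).ne
  have hQP : q.toReal < p.toReal := (ENNReal.toReal_lt_toReal (hqp.trans hp).ne hp.ne).2 hqp
  have hP : 0 < p.toReal := hQ.trans hQP
  have hc : (0 : ℝ) ≤ 2 ^ (-(1 / p.toReal)) := by positivity
  -- This makes `(c, c)` a unit vector of `ℓ_p²`, with `ℓ_q` norm `2 ^ (1/q - 1/p)`.
  refine ⟨2 ^ (-(1 / p.toReal)), hc, ?_, ?_⟩
  · rw [WithLp.prod_norm_eq_add hP]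
    simp only [WithLp.toLp_fst, WithLp.toLp_snd, Real.norm_of_nonneg hc]
    rw [← Real.rpow_mul zero_le_two, neg_mul, one_div_mul_cancel hP.ne', Real.rpow_neg_one]
    norm_num
  · rw [WithLp.prod_norm_eq_add hQ]
    simp only [WithLp.toLp_fst, WithLp.toLp_snd, Real.norm_of_nonneg hc]
    refine Real.one_lt_rpow ?_ (by positivity)
    rw [← Real.rpow_mul zero_le_two, ← two_mul]
    nth_rewrite 1 [← Real.rpow_one 2]
    rw [← Real.rpow_add two_pos]
    refine Real.one_lt_rpow one_lt_two ?_
    have : q.toReal / p.toReal < 1 := (div_lt_one hP).2 hQP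
    have h2 : -(1 / p.toReal) * q.toReal = -(q.toReal / p.toReal) := by ring
    rw [h2]
    linarith

variable {𝕜 : Type*} [RCLike 𝕜] {X Y : Type*} [NormedAddCommGroup X] [NormedSpace 𝕜 X]
  [NormedAddCommGroup Y] [NormedSpace 𝕜 Y]

/-- The operator `(x, a) ↦ (T x, c a)` from `X ⊕_p 𝕜` to `Y ⊕_q 𝕜`. -/
noncomputable def lpProdMap (p q : ℝ≥0∞) [Fact (1 ≤ p)] [Fact (1 ≤ q)] (T : X →L[𝕜] Y) (c : ℝ) :
    WithLp p (X × 𝕜) →L[𝕜] WithLp q (Y × 𝕜) :=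
  ((WithLp.prodContinuousLinearEquiv q 𝕜 Y 𝕜).symm : Y × 𝕜 →L[𝕜] WithLp q (Y × 𝕜)).comp
    ((T.prodMap ((c : 𝕜) • ContinuousLinearMap.id 𝕜 𝕜)).comp
      (WithLp.prodContinuousLinearEquiv p 𝕜 X 𝕜 : WithLp p (X × 𝕜) →L[𝕜] X × 𝕜))

variable {p q : ℝ≥0∞} [Fact (1 ≤ p)] [Fact (1 ≤ q)]

theorem lpProdMap_apply (T : X →L[𝕜] Y) (c : ℝ) (z : WithLp p (X × 𝕜)) :
    lpProdMap p q T c z = WithLp.toLp q (T z.fst, (c : 𝕜) * z.snd) := rfl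

theorem isCompactOperator_lpProdMap_zero (c : ℝ) :
    IsCompactOperator (lpProdMap p q (0 : X →L[𝕜] Y) c) := by
  have h : IsCompactOperator ((lpInr q : 𝕜 →L[𝕜] WithLp q (Y × 𝕜)).comp
      ((c : 𝕜) • WithLp.sndL p 𝕜 X 𝕜)) :=
    ((isCompactOperator_id (E := 𝕜)).comp_clm ((c : 𝕜) • WithLp.sndL p 𝕜 X 𝕜)).clm_comp (lpInr q)
  exact h

theorem norm_lpProdMap_sub_le (T : X →L[𝕜] Y) (c : ℝ) :
    ‖lpProdMap p q T c - lpProdMap p q 0 c‖ ≤ ‖T‖ := by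
  refine ContinuousLinearMap.opNorm_le_bound _ (norm_nonneg _) fun z => ?_
  have : (lpProdMap p q T c - lpProdMap p q 0 c : WithLp p (X × 𝕜) →L[𝕜] WithLp q (Y × 𝕜)) z =
      WithLp.toLp q (T z.fst, 0) := by
    rw [sub_apply, lpProdMap_apply, lpProdMap_apply, ← WithLp.toLp_sub]
    simp
  rw [this, WithLp.norm_toLp_fst]
  exact (T.le_opNorm _).trans (by gcongr; exact WithLp.norm_fst_le X z)

/-- Test on `(u x, w)` with `‖x‖ = 1` and `‖T x‖` close to `‖T‖`. Since `T` need not attain its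
norm, the bound at `‖T‖` is reached by closedness. -/
theorem le_norm_lpProdMap (T : X →L[𝕜] Y) {u w : ℝ} (hu : 0 ≤ u) (hw : 0 ≤ w)
    (huw : ‖(WithLp.toLp p (u, w) : WithLp p (ℝ × ℝ))‖ ≤ 1) :
    ‖T‖ * ‖(WithLp.toLp q (u, w) : WithLp q (ℝ × ℝ))‖ ≤ ‖lpProdMap p q T ‖T‖‖ := by
  rcases (norm_nonneg T).eq_or_lt with hT0 | hT0
  · rw [← hT0, zero_mul]
    exact norm_nonneg _
  let G : ℝ → ℝ := fun τ => ‖(WithLp.toLp q (u * τ, w * ‖T‖) : WithLp q (ℝ × ℝ))‖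
  have hG : Continuous G := by
    refine continuous_norm.comp ((WithLp.prod_continuous_toLp q ℝ ℝ).comp ?_)
    fun_prop
  have hcl : IsClosed {τ | G τ ≤ ‖lpProdMap p q T ‖T‖‖} := isClosed_le hG continuous_const
  have hmem : ‖T‖ ∈ closure {τ | G τ ≤ ‖lpProdMap p q T ‖T‖‖} := by
    rw [Metric.mem_closure_iff]
    intro ε hε
    obtain ⟨x, hx, hTx⟩ : ∃ x, ‖x‖ = 1 ∧ max 0 (‖T‖ - ε) < ‖T x‖ := by
      by_contra! hcon
      have := ContinuousLinearMap.opNorm_le_of_unit_norm (le_max_left _ _) hcon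
      exact this.not_gt (max_lt hT0 (sub_lt_self _ hε))
    have hTx₁ : ‖T x‖ ≤ ‖T‖ := by simpa [hx] using T.le_opNorm x
    have hTx₂ := (le_max_right _ _).trans_lt hTx
    refine ⟨‖T x‖, ?_, ?_⟩
    · have h := (lpProdMap p q T ‖T‖).le_opNorm (WithLp.toLp p ((u : 𝕜) • x, (w : 𝕜)))
      rw [lpProdMap_apply, WithLp.norm_toLp_prod_norm q, WithLp.norm_toLp_prod_norm p] at h
      simp only [WithLp.toLp_fst, WithLp.toLp_snd, map_smul, norm_smul, norm_mul,
        RCLike.norm_ofReal, abs_of_nonneg hu, abs_of_nonneg hw, abs_norm, hx, mul_one,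
        mul_comm ‖T‖ w] at h
      exact h.trans (mul_le_of_le_one_right (norm_nonneg _) huw)
    · rw [Real.dist_eq, abs_of_nonneg (by linarith)]
      linarith
  rw [hcl.closure_eq] at hmem
  have : G ‖T‖ = ‖T‖ * ‖(WithLp.toLp q (u, w) : WithLp q (ℝ × ℝ))‖ := by
    have h : (WithLp.toLp q (u * ‖T‖, w * ‖T‖) : WithLp q (ℝ × ℝ)) = ‖T‖ • WithLp.toLp q (u, w) := by
      rw [← WithLp.toLp_smul]
      simp [mul_comm]
    simp only [G, h, norm_smul, norm_norm]
  rw [← this]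
  exact hmem

/-- The dual norm of an `ℓ_q`-sum dominates the pairing of the norms of the components. -/
theorem norm_comp_inl_mul_add_le {g : StrongDual 𝕜 (WithLp q (Y × 𝕜))} (hg : ‖g‖ ≤ 1) {u w : ℝ}
    (hu : 0 ≤ u) (hw : 0 ≤ w) :
    ‖g.comp (lpInl q)‖ * u + ‖g (WithLp.toLp q (0, 1))‖ * w ≤
      ‖(WithLp.toLp q (u, w) : WithLp q (ℝ × ℝ))‖ := by
  set N := ‖(WithLp.toLp q (u, w) : WithLp q (ℝ × ℝ))‖ with hN
  set b := ‖g (WithLp.toLp q (0, 1))‖ with hb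
  have hb1 : b ≤ 1 := by
    refine (g.le_opNorm _).trans ?_
    rw [WithLp.norm_toLp_snd, norm_one, mul_one]
    exact hg
  have hwN : w ≤ N := by
    have := WithLp.norm_snd_le ℝ (WithLp.toLp q (u, w) : WithLp q (ℝ × ℝ))
    exact (le_abs_self w).trans this
  have hbw : 0 ≤ N - b * w := by nlinarith
  have key : ‖(u : 𝕜) • g.comp (lpInl q)‖ ≤ N - b * w := by
    refine ContinuousLinearMap.opNorm_le_of_unit_norm hbw fun y hy => ?_
    obtain ⟨θ, hθ, hθy⟩ := RCLike.exists_norm_eq_mul_self (g (WithLp.toLp q (y, 0)))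
    obtain ⟨η, hη, hηb⟩ := RCLike.exists_norm_eq_mul_self (g (WithLp.toLp q ((0 : Y), (1 : 𝕜))))
    -- The phases `θ`, `η` make both contributions to `g z` nonnegative reals without changing the
    -- norm.
    let z : WithLp q (Y × 𝕜) := WithLp.toLp q (((u : 𝕜) * θ) • y, (w : 𝕜) * η)
    have hz : ‖z‖ = N := by
      simp only [z, hN]
      rw [WithLp.norm_toLp_prod_norm, norm_smul, norm_mul, norm_mul, hθ, hη, hy]
      simp [abs_of_nonneg hu, abs_of_nonneg hw]
    have hz' : z = ((u : 𝕜) * θ) • WithLp.toLp q (y, 0) + ((w : 𝕜) * η) • WithLp.toLp q (0, 1) := by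
      rw [← WithLp.toLp_smul, ← WithLp.toLp_smul, ← WithLp.toLp_add]
      simp [z]
    have hgz : g z = ((u * ‖g (WithLp.toLp q (y, 0))‖ + w * b : ℝ) : 𝕜) := by
      rw [hz', map_add, map_smul, map_smul, smul_eq_mul, smul_eq_mul, mul_assoc, mul_assoc,
        ← hθy, ← hηb]
      push_cast
      rfl
    have h1 : ‖g z‖ ≤ N := by
      rw [← hz]
      exact (g.le_opNorm z).trans (mul_le_of_le_one_left (norm_nonneg _) hg)
    rw [hgz, RCLike.norm_ofReal] at h1
    have h2 := (le_abs_self _).trans h1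
    have h3 : ‖((u : 𝕜) • g.comp (lpInl q)) y‖ = u * ‖g (WithLp.toLp q (y, 0))‖ := by
      change ‖(u : 𝕜) • g (WithLp.toLp q (y, 0))‖ = _
      rw [norm_smul, RCLike.norm_ofReal, abs_of_nonneg hu]
    rw [h3]
    linarith
  rw [norm_smul, RCLike.norm_ofReal, abs_of_nonneg hu] at key
  linarith

/-- If the adjoint of `T` does not attain its norm, neither does the adjoint of
`(x, a) ↦ (T x, ‖T‖ a)`. -/
theorem norm_comp_lpProdMap_lt {T : X →L[𝕜] Y}
    (hlt : ∀ h : StrongDual 𝕜 Y, h ≠ 0 → ‖h.comp T‖ < ‖T‖ * ‖h‖)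
    (hS : ‖T‖ < ‖lpProdMap p q T ‖T‖‖) {g : StrongDual 𝕜 (WithLp q (Y × 𝕜))} (hg : ‖g‖ ≤ 1) :
    ‖g.comp (lpProdMap p q T ‖T‖)‖ < ‖lpProdMap p q T ‖T‖‖ := by
  set g₁ : StrongDual 𝕜 Y := g.comp (lpInl q) with hg₁
  set b := ‖g (WithLp.toLp q (0, 1))‖ with hb
  have hb1 : b ≤ 1 := by
    refine (g.le_opNorm _).trans ?_
    rw [WithLp.norm_toLp_snd, norm_one, mul_one]
    exact hg
  let G : WithLp p (ℝ × ℝ) → ℝ := fun z => ‖g₁.comp T‖ * |z.fst| + b * ‖T‖ * |z.snd|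
  have hG : Continuous G := by
    have h1 : Continuous fun z : WithLp p (ℝ × ℝ) => z.fst := WithLp.continuous_fst p ℝ ℝ
    have h2 : Continuous fun z : WithLp p (ℝ × ℝ) => z.snd := WithLp.continuous_snd p ℝ ℝ
    fun_prop
  have : FiniteDimensional ℝ (WithLp p (ℝ × ℝ)) :=
    (WithLp.linearEquiv p ℝ (ℝ × ℝ)).symm.finiteDimensional
  have : ProperSpace (WithLp p (ℝ × ℝ)) := FiniteDimensional.proper ℝ _
  -- `G` bounds `‖g (S z)‖` through the norms of the components of `z`. Its maximum over the plane
  -- ball is attained, so strict inequality at `z₀` suffices.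
  obtain ⟨z₀, hz₀, hmax⟩ := (isCompact_closedBall (0 : WithLp p (ℝ × ℝ)) 1).exists_isMaxOn
    ⟨0, by simp⟩ hG.continuousOn
  have hz₀' : ‖(WithLp.toLp p (|z₀.fst|, |z₀.snd|) : WithLp p (ℝ × ℝ))‖ ≤ 1 := by
    have := WithLp.norm_toLp_prod_norm p z₀.fst z₀.snd
    rw [Real.norm_eq_abs, Real.norm_eq_abs] at this
    rw [← this]
    exact mem_closedBall_zero_iff.1 hz₀
  have hle : ‖g.comp (lpProdMap p q T ‖T‖)‖ ≤ G z₀ := by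
    refine ContinuousLinearMap.opNorm_le_of_unit_norm (by positivity) fun z hz => ?_
    have hzz : ‖(WithLp.toLp p (‖z.fst‖, ‖z.snd‖) : WithLp p (ℝ × ℝ))‖ ≤ 1 := by
      rw [← WithLp.norm_toLp_prod_norm]
      exact hz.le
    refine le_trans ?_ (hmax (mem_closedBall_zero_iff.2 hzz))
    have h1 : lpProdMap p q T ‖T‖ z =
        (lpInl q : Y →L[𝕜] WithLp q (Y × 𝕜)) (T z.fst) + ((‖T‖ : 𝕜) * z.snd) • WithLp.toLp q ((0 : Y), (1 : 𝕜)) := by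
      change _ = WithLp.toLp q (T z.fst, (0 : 𝕜)) + _
      rw [lpProdMap_apply, ← WithLp.toLp_smul, ← WithLp.toLp_add]
      simp
    have h2 : g (lpInl q (T z.fst)) = (g₁.comp T) z.fst := rfl
    rw [ContinuousLinearMap.comp_apply, h1, map_add, map_smul, smul_eq_mul, h2]
    refine (norm_add_le _ _).trans ?_
    simp only [G, WithLp.toLp_fst, WithLp.toLp_snd, abs_norm]
    refine add_le_add ((g₁.comp T).le_opNorm _) (le_of_eq ?_)
    rw [norm_mul, norm_mul, RCLike.norm_ofReal, abs_norm]
    ring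
  refine hle.trans_lt ?_
  have hT : 0 ≤ ‖T‖ := norm_nonneg T
  have hw1 : |z₀.snd| ≤ 1 := by
    have := (WithLp.norm_snd_le ℝ z₀).trans (mem_closedBall_zero_iff.1 hz₀)
    simpa using this
  have hbw : b * ‖T‖ * |z₀.snd| ≤ ‖T‖ := by
    have h1 : b * ‖T‖ ≤ ‖T‖ := mul_le_of_le_one_left hT hb1
    exact (mul_le_of_le_one_right (by positivity) hw1).trans h1
  -- In the degenerate case only the scalar part remains, at most `‖T‖ < ‖S‖`. Otherwise
  -- non-attainment of `T*` gives `G z₀ < ‖T‖ (‖g₁‖ u + b w) ≤ ‖T‖ ‖(u, w)‖_q ≤ ‖S‖`, with `u`, `w`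
  -- the moduli of the coordinates of `z₀`.
  by_cases h0 : g₁ = 0 ∨ |z₀.fst| = 0
  · have : ‖g₁.comp T‖ * |z₀.fst| = 0 := by
      rcases h0 with h | h
      · simp [h]
      · rw [h, mul_zero]
    simp only [G, this, zero_add]
    exact hbw.trans_lt hS
  · rw [not_or] at h0
    have hu : 0 < |z₀.fst| := lt_of_le_of_ne (abs_nonneg _) (Ne.symm h0.2)
    have h1 := mul_lt_mul_of_pos_right (hlt g₁ h0.1) hu
    have h2 := mul_le_mul_of_nonneg_left
      (norm_comp_inl_mul_add_le hg hu.le (abs_nonneg z₀.snd)) hT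
    have h3 := le_norm_lpProdMap (q := q) T hu.le (abs_nonneg z₀.snd) hz₀'
    rw [← hg₁, ← hb] at h2
    simp only [G]
    linarith

/-- `𝓚(X ⊕_p 𝕜, Y ⊕_q 𝕜)` is not an M-ideal in `𝓛(X ⊕_p 𝕜, Y ⊕_q 𝕜)` if `q < p < ∞` and some
operator from `X` to `Y` has an adjoint that does not attain its norm. -/
theorem not_isMIdeal_compactOperator (hqp : q < p) (hp : p < ∞) {T : X →L[𝕜] Y}
    (hT : ¬ AttainsNorm (adjointOp T)) :
    ¬ IsMIdeal (compactOperator (RingHom.id 𝕜) (WithLp p (X × 𝕜)) (WithLp q (Y × 𝕜))) := by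
  intro hM
  have hadj : ‖adjointOp T‖ ≤ ‖T‖ := by
    refine ContinuousLinearMap.opNorm_le_bound _ (norm_nonneg _) fun h => ?_
    rw [mul_comm]
    exact h.opNorm_comp_le T
  have hlt₁ : ∀ h : StrongDual 𝕜 Y, ‖h‖ ≤ 1 → ‖h.comp T‖ < ‖T‖ := by
    intro h hh
    refine lt_of_lt_of_le (lt_of_le_of_ne ?_ fun he => hT ⟨h, hh, he⟩) hadj
    exact ((adjointOp T).le_opNorm h).trans (mul_le_of_le_one_right (norm_nonneg _) hh)
  have hT0 : 0 < ‖T‖ := by simpa using hlt₁ 0 (by simp)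
  have hlt : ∀ h : StrongDual 𝕜 Y, h ≠ 0 → ‖h.comp T‖ < ‖T‖ * ‖h‖ := by
    intro h hh
    have hn : 0 < ‖h‖ := norm_pos_iff.2 hh
    have h1 := hlt₁ (((‖h‖⁻¹ : ℝ) : 𝕜) • h) (by simp [norm_smul, hn.ne'])
    rw [ContinuousLinearMap.smul_comp, norm_smul, RCLike.norm_ofReal,
      abs_of_pos (inv_pos.2 hn), inv_mul_lt_iff₀ hn] at h1
    linarith
  have hS : ‖T‖ < ‖lpProdMap p q T ‖T‖‖ := by
    obtain ⟨c, hc, hc1, hc2⟩ := exists_norm_toLp_lt hqp hp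
    exact (lt_mul_of_one_lt_right hT0 hc2).trans_le (le_norm_lpProdMap T hc hc hc1)
  obtain ⟨g, hg, hgS⟩ := hM.exists_norm_comp_eq (isCompactOperator_lpProdMap_zero ‖T‖)
    ((norm_lpProdMap_sub_le (p := p) (q := q) T ‖T‖).trans_lt hS)
  exact hgS.not_gt (norm_comp_lpProdMap_lt hlt hS hg)

end LpSums

theorem mainTheorem9 {𝕜 : Type*} [RCLike 𝕜]
    {X : Type*} [NormedAddCommGroup X] [NormedSpace 𝕜 X] [CompleteSpace X]
    {Y : Type*} [NormedAddCommGroup Y] [NormedSpace 𝕜 Y] [CompleteSpace Y]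
    {p q : ℝ≥0∞} [Fact (1 ≤ p)] [Fact (1 ≤ q)] (hqp : q < p) (hp : p < ∞)
    (hX : 0 < numIndex 𝕜 (WithLp p (X × 𝕜)))
    (hY : 0 < numIndex 𝕜 (WithLp q (Y × 𝕜)))
    (hT : ∃ T : X →L[𝕜] Y, ¬ AttainsNorm (adjointOp T)) :
    ¬ IsMIdeal (NumRadOp.compacts 𝕜
        (WithLp ∞ (WithLp p (X × 𝕜) × WithLp q (Y × 𝕜)))) ∧
    ¬ IsMIdeal (NumRadOp.compacts 𝕜
        (WithLp 1 (WithLp p (X × 𝕜) × WithLp q (Y × 𝕜)))) := by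
  obtain ⟨T, hT⟩ := hT
  have h := not_isMIdeal_compactOperator hqp hp hT
  exact ⟨fun hM => h (isMIdeal_compactOperator_of_block ∞ norm_snd_apply_le_numRadius_top hM),
    fun hM => h (isMIdeal_compactOperator_of_block 1 norm_snd_apply_le_numRadius_one hM)⟩
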